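/- Consider logistic regression in the plane: given $Z\in\mathbb{R}^{n\times 2}$ with rows $Z_1,\dots,Z_n$ and labels $Y\in\{-1,1\}^n$, let $$\mathrm{OPT}(Z,Y)=\inf_{\beta\in\mathbb{R}^2}\sum_{i=1}^n\ln\bigl(1+\exp(-Y_iZ_i\beta)\bigr),\qquad \mathrm{OPT}^{\mathrm{aff}}(Z,Y)=\inf_{\beta\in\mathbb{R}^2,\,b\in\mathbb{R}}\sum_{i=1}^n\ln\bigl(1+\exp(-Y_i(Z_i\beta+b))\bigr)$$ be the optimal costs without and with an intercept. A randomized one-pass streaming algorithm with $s$ bits of space reads the labelled points $(Z_i,Y_i)$ one after the other, keeps only $s$ bits of memory between consecutive points (random coins, a clock and computation time are not charged), and reports a real number $v$ at the end. It approximates a value $\mathrm{OPT}\ge 0$ up to the factor $\alpha\ge 1$ with failure probability $\delta$ on a class of inputs if, on each input of the class, $\mathrm{OPT}/\alpha\le v\le\alpha\,\mathrm{OPT}$ except with probability at most $\delta$. For every $\delta\in[0,1/2)$ there are $c>0$ and $n_0$ such that for all $n\ge n_0$, all finite factors $\alpha\ge1$ and all $s$ the following hold for every such algorithm with $s$ bits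 of space. 1. If it approximates $\mathrm{OPT}$ up to the factor $\alpha$ with failure probability $\delta$ on all inputs of $n$ points (or merely on those whose coordinates are integers of absolute value at most $2^n$), then $s\ge c\,n/\log n$. 2. If it approximates $\mathrm{OPT}^{\mathrm{aff}}$ up to the factor $\alpha$ with failure probability $\delta$ on all inputs of $n$ points whose coordinates are integers of absolute value at most $n^2$ (so $O(\log n)$ bits per point), then $s\ge c\,n$; in terms of the total input size $N=\Theta(n\log n)$ in bits this is $s=\Omega(N/\log N)$. -/

import Mathlib

namespace LogisticStreaming

noncomputable section

/-- A data set of `n` labelled points in `ℝ^d`: the data matrix `Z ∈ ℝ^{n × d}` and the labels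
`Y ∈ {-1, 1}^n` (`ℤˣ` is the two-element type `{1, -1}`). -/
structure Instance (n d : ℕ) where
  Z : Matrix (Fin n) (Fin d) ℝ
  Y : Fin n → ℤˣ

namespace Instance

variable {n d : ℕ}

/-- The negative log-likelihood `∑ i, ln (1 + exp (-Yᵢ Zᵢ β))`. -/
def cost (I : Instance n d) (β : Fin d → ℝ) : ℝ :=
  ∑ i, Real.log (1 + Real.exp (-(((I.Y i : ℤ) : ℝ) * (I.Z i ⬝ᵥ β))))

/-- The optimal cost; an infimum, since it is not attained on separable data, where it is `0`. -/
def opt (I : Instance n d) : ℝ := ⨅ β : Fin d → ℝ, I.cost β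

/-- The negative log-likelihood of the model with intercept `b`. -/
def affineCost (I : Instance n d) (β : Fin d → ℝ) (b : ℝ) : ℝ :=
  ∑ i, Real.log (1 + Real.exp (-(((I.Y i : ℤ) : ℝ) * (I.Z i ⬝ᵥ β + b))))

/-- The optimal cost of the model with intercept. -/
def affineOpt (I : Instance n d) : ℝ := ⨅ p : (Fin d → ℝ) × ℝ, I.affineCost p.1 p.2

/-- The stream presenting the labelled points one after the other. -/
def stream (I : Instance n d) : List ((Fin d → ℝ) × ℤˣ) :=
  List.ofFn fun i => (I.Z i, I.Y i)

/-- All coordinates are integers of absolute value at most `M`. -/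
def OnGrid (I : Instance n d) (M : ℕ) : Prop :=
  ∀ i j, ∃ z : ℤ, I.Z i j = (z : ℝ) ∧ |z| ≤ (M : ℤ)

end Instance

/-- A randomized one-pass streaming algorithm with `s` bits of working memory that reads labelled
points of `ℝ^d` and reports a real number. `Ω` is the space of random coins. Coins, a clock and
computation time are free, and only the content of the memory is carried from one item to the
next; as the update sees the clock, this includes algorithms that toss fresh coins at each step.
-/
structure StreamingAlgorithm (Ω : Type*) (d s : ℕ) where
  init : Ω → (Fin s → Bool)
  update : Ω → ℕ → (Fin s → Bool) → (Fin d → ℝ) × ℤˣ → (Fin s → Bool)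
  output : Ω → (Fin s → Bool) → ℝ

namespace StreamingAlgorithm

variable {Ω : Type*} {d s : ℕ}

/-- The memory after reading a list of items, from memory content `m` at time `t`. -/
def runFrom (A : StreamingAlgorithm Ω d s) (ω : Ω) :
    ℕ → (Fin s → Bool) → List ((Fin d → ℝ) × ℤˣ) → (Fin s → Bool)
  | _, m, [] => m
  | t, m, p :: ps => A.runFrom ω (t + 1) (A.update ω t m p) ps

/-- The number reported after one pass over the data set. -/
def result (A : StreamingAlgorithm Ω d s) (ω : Ω) {n : ℕ} (I : Instance n d) : ℝ :=
  A.output ω (A.runFrom ω 0 (A.init ω) I.stream)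

end StreamingAlgorithm

/-- `v` approximates `x ≥ 0` up to the multiplicative factor `α ≥ 1`. -/
def ApproxWithin (α v x : ℝ) : Prop := x / α ≤ v ∧ v ≤ α * x

/-- On each data set of `n` points in the class `P`, the algorithm reports an `α`-approximation
of the target value, except with probability at most `δ` over its coins. -/
def Approximates {Ω : Type*} [MeasurableSpace Ω] (μ : MeasureTheory.Measure Ω) {d s : ℕ}
    (A : StreamingAlgorithm Ω d s) (n : ℕ) (P : Instance n d → Prop)
    (target : Instance n d → ℝ) (α δ : ℝ) : Prop :=
  ∀ I : Instance n d, P I →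
    μ {ω | ¬ ApproxWithin α (A.result ω I) (target I)} ≤ ENNReal.ofReal δ

end

end LogisticStreaming

/-!
The reduction is from augmented indexing. Alice holds a bit string `x`, Bob holds an index `i` and
the bits of `x` above `i`, and Bob has to find `x i` from one message of Alice. For a fixed message,
the pattern of Bob's mistakes determines `x`: recover the bits from the top one down. So if `x` is
uniform, the score (right minus wrong guesses) behaves, up to a factor counting the messages, like a
sum of independent random signs. Its exponential moments force the logarithm of the number of
messages to be linear in the length of `x` as soon as the error probability is below `1 / 2`.

The optimal logistic cost is `0` exactly on strictly separable data, and a multiplicative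
approximation must recognise the value `0`, so it suffices to encode `x i` as separability. Without
an intercept, `(a, 1)` labelled `1`, `(b, 1)` labelled `-1` and `(1, 0)` labelled `1` are separable
if and only if `b < a`, and comparing binary expansions hides all bits of `x` in `a` alone. With an
intercept, a point of a parabola is separable from any finite set of other points of the parabola,
so that one can test membership in a set of integers.
-/

namespace LogisticStreaming

open Finset MeasureTheory

/-! ### Augmented indexing -/

section SignSum

variable {ι : Type*} [Fintype ι]

/-- The sum of the signs `(-1) ^ E i`. For an error pattern `E` this is the number of right guesses
minus the number of wrong ones. -/
def signSum (E : ι → Bool) : ℝ := ∑ i, if E i then -1 else 1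

theorem signSum_eq_card_sub (E : ι → Bool) :
    signSum E = Fintype.card ι - 2 * #{i | E i = true} := by
  have hterm (i : ι) : (if E i then (-1 : ℝ) else 1) = 1 - 2 * if E i = true then 1 else 0 := by
    split_ifs <;> norm_num
  simp only [signSum, hterm, sum_sub_distrib, ← mul_sum, sum_boole]
  simp

theorem sum_exp_mul_signSum [DecidableEq ι] (u : ℝ) :
    ∑ E : ι → Bool, Real.exp (u * signSum E) = (2 * Real.cosh u) ^ Fintype.card ι := by
  calc ∑ E : ι → Bool, Real.exp (u * signSum E)
      = ∑ E : ι → Bool, ∏ i, Real.exp (u * if E i then -1 else 1) := by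
        simp only [signSum, mul_sum, Real.exp_sum]
    _ = ∏ _i : ι, ∑ b : Bool, Real.exp (u * if b then -1 else 1) := by
        rw [prod_univ_sum, Fintype.piFinset_univ]
    _ = (2 * Real.cosh u) ^ Fintype.card ι := by
        simp [Real.cosh_eq, add_comm, mul_div_cancel₀]

end SignSum

theorem card_mul_exp_le_sum_exp {κ : Type*} [Fintype κ] {f : κ → ℝ} {a : ℝ}
    (h : Fintype.card κ * a ≤ ∑ k, f k) :
    Fintype.card κ * Real.exp a ≤ ∑ k, Real.exp (f k) := by
  calc Fintype.card κ * Real.exp a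
      ≤ Real.exp a * (∑ k, f k - Fintype.card κ * a + Fintype.card κ) := by
        rw [mul_comm]
        gcongr
        linarith
    _ = ∑ k, Real.exp a * (f k - a + 1) := by
        simp [← mul_sum, sum_add_distrib]
    _ ≤ ∑ k, Real.exp a * Real.exp (f k - a) := by
        gcongr with k
        exact Real.add_one_le_exp _
    _ = ∑ k, Real.exp (f k) := by
        simp only [← Real.exp_add, add_sub_cancel]

theorem exists_card_filter_mem_le_sum_measure {κ Ω : Type*} [Fintype κ] [MeasurableSpace Ω]
    (μ : Measure Ω) [IsProbabilityMeasure μ] (S : κ → Set Ω) [∀ ω, DecidablePred (ω ∈ S ·)] :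
    ∃ ω, (#{k | ω ∈ S k} : ENNReal) ≤ ∑ k, μ (S k) := by
  set T : κ → Set Ω := fun k => toMeasurable μ (S k)
  have hT (k : κ) : Measurable ((T k).indicator (1 : Ω → ENNReal)) :=
    measurable_one.indicator (measurableSet_toMeasurable μ (S k))
  obtain ⟨ω, hω⟩ := exists_le_lintegral (μ := μ)
    (Finset.measurable_sum univ fun k _ => hT k).aemeasurable
  refine ⟨ω, ?_⟩
  calc (#{k | ω ∈ S k} : ENNReal)
      = ∑ k, (S k).indicator 1 ω := by
        simp [Set.indicator_apply]
    _ ≤ ∑ k, (T k).indicator 1 ω := by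
        gcongr with k
        exact subset_toMeasurable μ (S k)
    _ ≤ ∫⁻ ω, ∑ k, (T k).indicator 1 ω ∂μ := by
        simpa only [Finset.sum_apply] using hω
    _ = ∑ k, μ (S k) := by
        rw [lintegral_finsetSum _ fun k _ => hT k]
        simp only [T, lintegral_indicator_one (measurableSet_toMeasurable μ _),
          measure_toMeasurable]

/-- A deterministic one-way protocol for augmented indexing with messages in `M`. The sender holds
`x : ι → Bool`; the receiver holds an index `i` and the bits of `x` above `i` and guesses `x i`.
The guess takes all of `x` as argument, but by `guess_congr` it depends on the bits above `i` only.
-/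
structure AugmentedIndexProtocol (ι M : Type*) [LT ι] where
  message : (ι → Bool) → M
  guess : M → ι → (ι → Bool) → Bool
  guess_congr : ∀ w i x y, (∀ j, i < j → x j = y j) → guess w i x = guess w i y

namespace AugmentedIndexProtocol

variable {ι M : Type*} [Preorder ι]

/-- The indices at which a receiver who got the message `w` guesses a bit of `x` wrongly. -/
def errorPattern (P : AugmentedIndexProtocol ι M) (w : M) (x : ι → Bool) : ι → Bool :=
  fun i => P.guess w i x != x i

theorem errorPattern_injective [Finite ι] (P : AugmentedIndexProtocol ι M) (w : M) :
    Function.Injective (P.errorPattern w) := by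
  classical
  have := Fintype.ofFinite ι
  intro x y hxy
  by_contra! hne
  obtain ⟨i₀, hi₀⟩ := Function.ne_iff.1 hne
  obtain ⟨i, hi, hmax⟩ := exists_maximal (s := ({i | x i ≠ y i} : Finset ι)) ⟨i₀, by simpa⟩
  have hagree (j : ι) (hij : i < j) : x j = y j := by
    by_contra hj
    exact hij.not_ge (hmax (by simpa using hj) hij.le)
  have hi' : (P.guess w i x != x i) = (P.guess w i y != y i) := congrFun hxy i
  rw [P.guess_congr w i x y hagree, Bool.bne_right_inj] at hi'
  exact (mem_filter.1 hi).2 hi'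

variable [Fintype ι]

theorem sum_signSum_errorPattern [DecidableEq ι] (P : AugmentedIndexProtocol ι M) :
    ∑ x, signSum (P.errorPattern (P.message x) x) =
      2 ^ Fintype.card ι * Fintype.card ι -
        2 * #{p : (ι → Bool) × ι | P.guess (P.message p.1) p.2 p.1 ≠ p.1 p.2} := by
  simp [signSum_eq_card_sub, errorPattern, ← mul_sum, card_filter, Fintype.sum_prod_type]

variable [Fintype M]

theorem sum_exp_mul_signSum_errorPattern_le [DecidableEq ι] (P : AugmentedIndexProtocol ι M)
    (u : ℝ) :
    ∑ x, Real.exp (u * signSum (P.errorPattern (P.message x) x)) ≤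
      Fintype.card M * (2 * Real.cosh u) ^ Fintype.card ι := by
  calc ∑ x, Real.exp (u * signSum (P.errorPattern (P.message x) x))
      ≤ ∑ x, ∑ w, Real.exp (u * signSum (P.errorPattern w x)) := by
        gcongr with x
        exact single_le_sum (f := fun w => Real.exp (u * signSum (P.errorPattern w x)))
          (fun w _ => (Real.exp_pos _).le) (mem_univ (P.message x))
    _ = ∑ w, ∑ x, Real.exp (u * signSum (P.errorPattern w x)) := sum_comm
    _ = ∑ _w : M, ∑ E : ι → Bool, Real.exp (u * signSum E) := by
        refine sum_congr rfl fun w _ => ?_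
        exact (Finite.injective_iff_bijective.1 (P.errorPattern_injective w)).sum_comp
          fun E => Real.exp (u * signSum E)
    _ = Fintype.card M * (2 * Real.cosh u) ^ Fintype.card ι := by
        simp [sum_exp_mul_signSum]

theorem sq_mul_card_le_log_card [DecidableEq ι] {δ : ℝ} (hδ : δ ≤ 1 / 2)
    (P : AugmentedIndexProtocol ι M)
    (herr : (#{p : (ι → Bool) × ι | P.guess (P.message p.1) p.2 p.1 ≠ p.1 p.2} : ℝ) ≤
      2 ^ Fintype.card ι * Fintype.card ι * δ) :
    (1 - 2 * δ) ^ 2 / 2 * Fintype.card ι ≤ Real.log (Fintype.card M) := by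
  set m := Fintype.card ι
  set u := 1 - 2 * δ
  have hu₀ : 0 ≤ u := by linarith
  have hcard : Fintype.card (ι → Bool) = (2 : ℝ) ^ m := by simp [m]
  have haverage : Fintype.card (ι → Bool) * (u * (u * m)) ≤
      ∑ x, u * signSum (P.errorPattern (P.message x) x) := by
    rw [← mul_sum, P.sum_signSum_errorPattern, mul_left_comm, hcard]
    gcongr
    linarith
  have hexp : 2 ^ m * Real.exp (u ^ 2 * m) ≤
      2 ^ m * (Fintype.card M * Real.exp (u ^ 2 / 2 * m)) := by
    calc 2 ^ m * Real.exp (u ^ 2 * m)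
        = Fintype.card (ι → Bool) * Real.exp (u * (u * m)) := by rw [hcard]; ring_nf
      _ ≤ Fintype.card M * (2 * Real.cosh u) ^ m :=
          (card_mul_exp_le_sum_exp haverage).trans (P.sum_exp_mul_signSum_errorPattern_le u)
      _ ≤ Fintype.card M * (2 * Real.exp (u ^ 2 / 2)) ^ m := by
          gcongr
          exact Real.cosh_le_exp_half_sq u
      _ = 2 ^ m * (Fintype.card M * Real.exp (u ^ 2 / 2 * m)) := by
          rw [mul_pow, ← Real.exp_nat_mul]
          ring_nf
  have hM : (0 : ℝ) < Fintype.card M :=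
    Nat.cast_pos.2 (Fintype.card_pos_iff.2 ⟨P.message fun _ => false⟩)
  rw [Real.le_log_iff_exp_le hM]
  refine le_of_mul_le_mul_right ?_ (Real.exp_pos (u ^ 2 / 2 * m))
  rw [← Real.exp_add]
  convert le_of_mul_le_mul_left hexp (by positivity) using 2
  ring

theorem sq_mul_card_le_log_card_of_measure_le {Ω : Type*} [MeasurableSpace Ω] (μ : Measure Ω)
    [IsProbabilityMeasure μ] {δ : ℝ} (hδ₀ : 0 ≤ δ) (hδ : δ ≤ 1 / 2)
    (P : Ω → AugmentedIndexProtocol ι M)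
    (herr : ∀ x i, μ {ω | (P ω).guess ((P ω).message x) i x ≠ x i} ≤ ENNReal.ofReal δ) :
    (1 - 2 * δ) ^ 2 / 2 * Fintype.card ι ≤ Real.log (Fintype.card M) := by
  classical
  obtain ⟨ω, hω⟩ := exists_card_filter_mem_le_sum_measure μ fun p : (ι → Bool) × ι =>
    {ω | (P ω).guess ((P ω).message p.1) p.2 p.1 ≠ p.1 p.2}
  refine (P ω).sq_mul_card_le_log_card hδ ?_
  rw [← ENNReal.ofReal_le_ofReal_iff (by positivity), ENNReal.ofReal_natCast]
  calc _ ≤ ∑ p : (ι → Bool) × ι, μ {ω | (P ω).guess ((P ω).message p.1) p.2 p.1 ≠ p.1 p.2} := hω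
    _ ≤ ∑ _p : (ι → Bool) × ι, ENNReal.ofReal δ := sum_le_sum fun p _ => herr p.1 p.2
    _ = ENNReal.ofReal (2 ^ Fintype.card ι * Fintype.card ι * δ) := by
        rw [ENNReal.ofReal_mul (by positivity), ENNReal.ofReal_mul (by positivity),
          ENNReal.ofReal_pow (by norm_num)]
        simp

end AugmentedIndexProtocol

/-! ### Streaming algorithms as protocols -/

/-- A point of `ℝ^d` with a label, the type of the items of a stream. -/
abbrev LabelledPoint (d : ℕ) : Type := (Fin d → ℝ) × ℤˣ

/-- The data set with the given labelled points. -/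
def Instance.ofPoints {n d : ℕ} (p : Fin n → LabelledPoint d) : Instance n d where
  Z i := (p i).1
  Y i := (p i).2

namespace StreamingAlgorithm

variable {Ω : Type*} {d s : ℕ} (A : StreamingAlgorithm Ω d s) (ω : Ω)

theorem runFrom_append (t : ℕ) (w : Fin s → Bool) (p q : List (LabelledPoint d)) :
    A.runFrom ω t w (p ++ q) = A.runFrom ω (t + p.length) (A.runFrom ω t w p) q := by
  induction p generalizing t w with
  | nil => rfl
  | cons a p ih =>
    simp only [List.cons_append, runFrom, List.length_cons, ih, Nat.add_assoc, Nat.add_comm 1]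

theorem result_ofPoints_append {k l : ℕ} (p : Fin k → LabelledPoint d)
    (q : Fin l → LabelledPoint d) :
    A.result ω (.ofPoints (Fin.append p q)) =
      A.output ω (A.runFrom ω k (A.runFrom ω 0 (A.init ω) (List.ofFn p)) (List.ofFn q)) := by
  have hstream : (Instance.ofPoints (Fin.append p q)).stream = List.ofFn p ++ List.ofFn q :=
    List.ofFn_fin_append p q
  simp [result, hstream, runFrom_append]

/-- The sender runs the algorithm on `alice x` and sends the memory content; the receiver continues
on `bob i x` and guesses `true` if the reported number is `0`. -/
noncomputable def toProtocol {ι : Type*} [LT ι] {k l : ℕ}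
    (alice : (ι → Bool) → Fin k → LabelledPoint d)
    (bob : ι → (ι → Bool) → Fin l → LabelledPoint d)
    (hbob : ∀ i x y, (∀ j, i < j → x j = y j) → bob i x = bob i y) :
    AugmentedIndexProtocol ι (Fin s → Bool) where
  message x := A.runFrom ω 0 (A.init ω) (List.ofFn (alice x))
  guess w i x := decide (A.output ω (A.runFrom ω k w (List.ofFn (bob i x))) = 0)
  guess_congr w i x y h := by rw [hbob i x y h]

end StreamingAlgorithm

theorem ApproxWithin.eq_zero_iff {α v x : ℝ} (h : ApproxWithin α v x) (hα : 0 < α) (hx : 0 ≤ x) :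
    v = 0 ↔ x = 0 := by
  obtain ⟨hlower, hupper⟩ := h
  constructor
  · rintro rfl
    have hx' : x ≤ 0 := by simpa using (div_le_iff₀ hα).1 hlower
    exact hx'.antisymm hx
  · rintro rfl
    simp only [zero_div, mul_zero] at hlower hupper
    exact hupper.antisymm hlower

theorem Approximates.sq_mul_card_le_space {Ω : Type*} [MeasurableSpace Ω] {μ : Measure Ω}
    [IsProbabilityMeasure μ] {d s k l : ℕ} {A : StreamingAlgorithm Ω d s}
    {Q : Instance (k + l) d → Prop} {target : Instance (k + l) d → ℝ} {α δ : ℝ}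
    (hA : Approximates μ A (k + l) Q target α δ) (hα : 0 < α) (hδ₀ : 0 ≤ δ) (hδ : δ ≤ 1 / 2)
    {ι : Type*} [Fintype ι] [Preorder ι] (alice : (ι → Bool) → Fin k → LabelledPoint d)
    (bob : ι → (ι → Bool) → Fin l → LabelledPoint d)
    (hbob : ∀ i x y, (∀ j, i < j → x j = y j) → bob i x = bob i y)
    (hQ : ∀ x i, Q (.ofPoints (Fin.append (alice x) (bob i x))))
    (htarget : ∀ I, 0 ≤ target I)
    (hzero : ∀ x i, target (.ofPoints (Fin.append (alice x) (bob i x))) = 0 ↔ x i = true) :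
    (1 - 2 * δ) ^ 2 / 2 * Fintype.card ι ≤ s := by
  classical
  have hmemory : Real.log (Fintype.card (Fin s → Bool)) ≤ s := by
    have hlog : Real.log 2 ≤ 1 := by linarith [Real.log_two_lt_d9]
    simpa using mul_le_of_le_one_right s.cast_nonneg hlog
  refine (AugmentedIndexProtocol.sq_mul_card_le_log_card_of_measure_le μ hδ₀ hδ
    (fun ω => A.toProtocol ω alice bob hbob) fun x i => ?_).trans hmemory
  refine (measure_mono ?_).trans (hA _ (hQ x i))
  intro ω hwrong happrox
  refine hwrong ?_
  have hiff := (happrox.eq_zero_iff hα (htarget _)).trans (hzero x i)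
  rw [A.result_ofPoints_append] at hiff
  exact Bool.eq_iff_iff.2 (decide_eq_true_iff.trans hiff)

/-! ### Vanishing of the optimal cost -/

section LogisticLoss

variable {ι : Type*} [Fintype ι]

theorem log_one_add_exp_nonneg (t : ℝ) : 0 ≤ Real.log (1 + Real.exp t) :=
  Real.log_nonneg (by linarith [Real.exp_pos t])

theorem sum_log_one_add_exp_neg_nonneg (a : ι → ℝ) : 0 ≤ ∑ i, Real.log (1 + Real.exp (-a i)) :=
  sum_nonneg fun i _ => log_one_add_exp_nonneg (-a i)

theorem log_two_le_sum_log_one_add_exp_neg {a : ι → ℝ} {i : ι} (hi : a i ≤ 0) :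
    Real.log 2 ≤ ∑ i, Real.log (1 + Real.exp (-a i)) := by
  calc Real.log 2 ≤ Real.log (1 + Real.exp (-a i)) :=
        Real.log_le_log two_pos (by linarith [Real.one_le_exp (neg_nonneg.2 hi)])
    _ ≤ ∑ i, Real.log (1 + Real.exp (-a i)) :=
        single_le_sum (f := fun i => Real.log (1 + Real.exp (-a i)))
          (fun i _ => log_one_add_exp_nonneg (-a i)) (mem_univ i)

theorem tendsto_sum_log_one_add_exp_neg_mul {a : ι → ℝ} (ha : ∀ i, 0 < a i) :
    Filter.Tendsto (fun c : ℝ => ∑ i, Real.log (1 + Real.exp (-(c * a i)))) Filter.atTop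
      (nhds 0) := by
  have hterm (i : ι) : Filter.Tendsto (fun c : ℝ => Real.log (1 + Real.exp (-(c * a i))))
      Filter.atTop (nhds 0) := by
    have hexp : Filter.Tendsto (fun c : ℝ => 1 + Real.exp (-(c * a i))) Filter.atTop (nhds 1) := by
      simpa using (Real.tendsto_exp_neg_atTop_nhds_zero.comp
        (Filter.tendsto_id.atTop_mul_const (ha i))).const_add 1
    simpa using hexp.log one_ne_zero
  simpa using tendsto_finsetSum univ fun i _ => hterm i

theorem iInf_sum_log_one_add_exp_neg_eq_zero_iff {V : Type*} [Nonempty V] [SMul ℝ V]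
    (margin : V → ι → ℝ) (hsmul : ∀ (c : ℝ) v, margin (c • v) = c • margin v) :
    ⨅ v, ∑ i, Real.log (1 + Real.exp (-margin v i)) = 0 ↔ ∃ v, ∀ i, 0 < margin v i := by
  constructor
  · contrapose!
    intro h
    refine ((Real.log_pos one_lt_two).trans_le (le_ciInf fun v => ?_)).ne'
    obtain ⟨i, hi⟩ := h v
    exact log_two_le_sum_log_one_add_exp_neg hi
  · rintro ⟨v, hv⟩
    refine le_antisymm (ge_of_tendsto' (tendsto_sum_log_one_add_exp_neg_mul hv) fun c => ?_)
      (Real.iInf_nonneg fun v => sum_log_one_add_exp_neg_nonneg (margin v))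
    have hbdd : BddBelow (Set.range fun v => ∑ i, Real.log (1 + Real.exp (-margin v i))) :=
      ⟨0, Set.forall_mem_range.2 fun v => sum_log_one_add_exp_neg_nonneg (margin v)⟩
    simpa only [hsmul, Pi.smul_apply, smul_eq_mul] using ciInf_le hbdd (c • v)

end LogisticLoss

namespace Instance

variable {n d : ℕ} (I : Instance n d)

theorem opt_nonneg : 0 ≤ I.opt :=
  Real.iInf_nonneg fun β => sum_log_one_add_exp_neg_nonneg fun i =>
    ((I.Y i : ℤ) : ℝ) * (I.Z i ⬝ᵥ β)

theorem affineOpt_nonneg : 0 ≤ I.affineOpt :=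
  Real.iInf_nonneg fun p => sum_log_one_add_exp_neg_nonneg fun i =>
    ((I.Y i : ℤ) : ℝ) * (I.Z i ⬝ᵥ p.1 + p.2)

theorem opt_eq_zero_iff :
    I.opt = 0 ↔ ∃ β : Fin d → ℝ, ∀ i, 0 < ((I.Y i : ℤ) : ℝ) * (I.Z i ⬝ᵥ β) :=
  iInf_sum_log_one_add_exp_neg_eq_zero_iff (fun (β : Fin d → ℝ) i =>
    ((I.Y i : ℤ) : ℝ) * (I.Z i ⬝ᵥ β)) fun c β => by
      ext i
      simp [mul_left_comm]

theorem affineOpt_eq_zero_iff :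
    I.affineOpt = 0 ↔
      ∃ (β : Fin d → ℝ) (b : ℝ), ∀ i, 0 < ((I.Y i : ℤ) : ℝ) * (I.Z i ⬝ᵥ β + b) := by
  rw [← Prod.exists (p := fun p : (Fin d → ℝ) × ℝ =>
    ∀ i, 0 < ((I.Y i : ℤ) : ℝ) * (I.Z i ⬝ᵥ p.1 + p.2))]
  refine iInf_sum_log_one_add_exp_neg_eq_zero_iff (fun (p : (Fin d → ℝ) × ℝ) i =>
    ((I.Y i : ℤ) : ℝ) * (I.Z i ⬝ᵥ p.1 + p.2)) fun c p => ?_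
  ext i
  simp [mul_left_comm, ← mul_add]

end Instance

/-! ### Hard data sets -/

section PlanarPoint

variable {d : ℕ}

/-- The vector of `ℝ^(d + 2)` with first two coordinates `a` and `b` and all others `0`; it embeds
the planar constructions into every dimension at least two. -/
def planarPoint (d : ℕ) (a b : ℝ) : Fin (d + 2) → ℝ :=
  Matrix.vecCons a (Matrix.vecCons b 0)

@[simp]
theorem planarPoint_dotProduct (a b : ℝ) (β : Fin (d + 2) → ℝ) :
    planarPoint d a b ⬝ᵥ β = a * β 0 + b * β 1 := by
  simp [planarPoint, Matrix.vecHead, Matrix.vecTail]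

@[simp]
theorem planarPoint_zero (a b : ℝ) : planarPoint d a b 0 = a := rfl

@[simp]
theorem planarPoint_one (a b : ℝ) : planarPoint d a b 1 = b := rfl

theorem exists_int_eq_planarPoint {a b B : ℕ} (ha : a ≤ B) (hb : b ≤ B) (j : Fin (d + 2)) :
    ∃ z : ℤ, planarPoint d a b j = z ∧ |z| ≤ (B : ℤ) := by
  have hnat {c : ℕ} (hc : c ≤ B) : ∃ z : ℤ, (c : ℝ) = z ∧ |z| ≤ (B : ℤ) :=
    ⟨c, by simp, by simpa using hc⟩
  refine Fin.cases (hnat ha) (fun j => Fin.cases (hnat hb) (fun j => ?_) j) j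
  simpa [planarPoint] using hnat (Nat.zero_le B)

theorem exists_separating_iff_lt (a b : ℝ) :
    (∃ β : Fin (d + 2) → ℝ, 0 < a * β 0 + β 1 ∧ b * β 0 + β 1 < 0 ∧ 0 < β 0) ↔ b < a := by
  constructor
  · rintro ⟨β, ha, hb, hβ⟩
    exact lt_of_mul_lt_mul_right (by linarith) hβ.le
  · intro h
    refine ⟨planarPoint d 2 (-(a + b)), ?_⟩
    simp only [planarPoint_zero, planarPoint_one]
    exact ⟨by linarith, by linarith, two_pos⟩

theorem exists_separating_parabola_iff {ι : Type*} (v : ι → ℕ) (w : ℕ) :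
    (∃ (β : Fin (d + 2) → ℝ) (b : ℝ), (∀ j, 0 < v j * β 0 + (v j : ℝ) ^ 2 * β 1 + b) ∧
      w * β 0 + (w : ℝ) ^ 2 * β 1 + b < 0) ↔ ∀ j, v j ≠ w := by
  constructor
  · rintro ⟨β, b, hpos, hneg⟩ j rfl
    exact lt_asymm (hpos j) hneg
  · intro hne
    -- The separating functional is `t ↦ (t - w) ^ 2 - 1 / 2`.
    refine ⟨planarPoint d (-2 * w) 1, (w : ℝ) ^ 2 - 1 / 2, fun j => ?_, ?_⟩
    · have hsq : (1 : ℝ) ≤ ((v j : ℝ) - w) ^ 2 := by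
        have hint : ((v j : ℤ) - w) ≠ 0 := sub_ne_zero.2 (by exact_mod_cast hne j)
        exact_mod_cast (sq_pos_of_ne_zero hint : 0 < ((v j : ℤ) - w) ^ 2)
      simp only [planarPoint_zero, planarPoint_one]
      linarith
    · simp only [planarPoint_zero, planarPoint_one]
      linarith

end PlanarPoint

/-- The largest number whose binary digits above `i` are those of `x` and whose `i`-th digit is
`0`. -/
def threshold {m : ℕ} (i : Fin m) (x : Fin m → Bool) : ℕ :=
  Nat.ofBits fun j => if i < j then x j else decide (j < i)

theorem threshold_congr {m : ℕ} {i : Fin m} {x y : Fin m → Bool} (h : ∀ j, i < j → x j = y j) :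
    threshold i x = threshold i y := by
  unfold threshold
  congr! 3 with j hj
  exact h j hj

theorem threshold_lt_ofBits_iff {m : ℕ} (i : Fin m) (x : Fin m → Bool) :
    threshold i x < Nat.ofBits x ↔ x i = true := by
  cases hx : x i with
  | true =>
    refine iff_of_true (Nat.lt_of_testBit i ?_ ?_ fun j hj => ?_) rfl
    · simp [threshold]
    · simpa using hx
    · rcases lt_or_ge j m with hjm | hjm
      · have hij : i < ⟨j, hjm⟩ := hj
        simp [threshold, hjm, hij]
      · simp [threshold, hjm]
  | false =>
    refine iff_of_false (Nat.le_of_testBit fun j hj => ?_).not_gt Bool.false_ne_true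
    obtain ⟨hjm, hxj⟩ : ∃ hjm : j < m, x ⟨j, hjm⟩ = true := by
      simpa [Nat.testBit_ofBits] using hj
    have hij : ⟨j, hjm⟩ ≠ i := by
      rintro rfl
      simp [hx] at hxj
    rcases hij.lt_or_gt with h | h
    · simp [threshold, hjm, h, h.not_gt]
    · simp [threshold, hjm, h, hxj]

/-- The abscissa of the `j`-th positive point on the parabola: it is `j` if `x j` is false, and the
dummy value `m` otherwise. -/
def abscissa {m : ℕ} (x : Fin m → Bool) (j : Fin m) : ℕ := if x j then m else j

theorem abscissa_le {m : ℕ} (x : Fin m → Bool) (j : Fin m) : abscissa x j ≤ m := by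
  unfold abscissa
  split_ifs <;> omega

theorem forall_abscissa_ne_iff {m : ℕ} (x : Fin m → Bool) (i : Fin m) :
    (∀ j, abscissa x j ≠ i) ↔ x i = true := by
  constructor
  · intro h
    by_contra hx
    exact h i (if_neg hx)
  · intro hx j
    unfold abscissa
    split_ifs with hj
    · exact i.2.ne'
    · exact fun hji => hj (Fin.ext hji ▸ hx)

/-! ### The lower bounds -/

namespace Approximates

variable {Ω : Type*} [MeasurableSpace Ω] {μ : Measure Ω} [IsProbabilityMeasure μ] {d s n : ℕ}
  {A : StreamingAlgorithm Ω (d + 2) s} {α δ : ℝ}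

theorem sq_mul_le_space_of_opt (hn : 3 ≤ n)
    (hA : Approximates μ A n (fun I => I.OnGrid (2 ^ n)) (fun I => I.opt) α δ)
    (hα : 0 < α) (hδ₀ : 0 ≤ δ) (hδ : δ ≤ 1 / 2) :
    (1 - 2 * δ) ^ 2 / 2 * n ≤ s := by
  obtain ⟨k, rfl⟩ : ∃ k, n = 1 + (k + 2) := ⟨n - 3, by omega⟩
  have hone : 1 ≤ 2 ^ (1 + (k + 2)) := Nat.one_le_two_pow
  have hbound := hA.sq_mul_card_le_space hα hδ₀ hδ (ι := Fin (1 + (k + 2)))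
    (fun x _ => (planarPoint d (Nat.ofBits x) (1 : ℕ), 1))
    (fun i x => Fin.cons (planarPoint d (threshold i x) (1 : ℕ), -1)
      fun _ => (planarPoint d (1 : ℕ) (0 : ℕ), 1))
    (fun i x y h => by rw [threshold_congr h]) (fun x i => ?_) Instance.opt_nonneg fun x i => ?_
  · simpa using hbound
  · simp only [Instance.OnGrid, Instance.ofPoints, Fin.forall_fin_add (m := 1), Fin.append_left,
      Fin.append_right, Fin.forall_fin_succ (n := k + 1), Fin.cons_zero, Fin.cons_succ]
    exact ⟨fun _ => exists_int_eq_planarPoint (Nat.ofBits_lt_two_pow x).le hone,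
      exists_int_eq_planarPoint (Nat.ofBits_lt_two_pow _).le hone,
      fun _ => exists_int_eq_planarPoint hone (Nat.zero_le _)⟩
  · rw [Instance.opt_eq_zero_iff, ← threshold_lt_ofBits_iff, ← Nat.cast_lt (α := ℝ),
      ← exists_separating_iff_lt (d := d)]
    simp [-neg_add_rev, Instance.ofPoints, Fin.forall_fin_add, Fin.forall_fin_succ (n := k + 1)]

theorem sq_mul_le_space_of_affineOpt
    (hA : Approximates μ A (n + 1) (fun I => I.OnGrid ((n + 1) ^ 2)) (fun I => I.affineOpt) α δ)
    (hα : 0 < α) (hδ₀ : 0 ≤ δ) (hδ : δ ≤ 1 / 2) :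
    (1 - 2 * δ) ^ 2 / 2 * n ≤ s := by
  have hgrid {a : ℕ} (ha : a ≤ n) :
      ∀ j, ∃ z : ℤ, planarPoint d a (a ^ 2 : ℕ) j = z ∧ |z| ≤ (((n + 1) ^ 2 : ℕ) : ℤ) :=
    exists_int_eq_planarPoint (by nlinarith) (by gcongr; omega)
  have hbound := hA.sq_mul_card_le_space hα hδ₀ hδ (ι := Fin n)
    (fun x j => (planarPoint d (abscissa x j) (abscissa x j ^ 2 : ℕ), 1))
    (fun i _ _ => (planarPoint d (i : ℕ) ((i : ℕ) ^ 2 : ℕ), -1))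
    (fun _ _ _ _ => rfl) (fun x i => ?_) Instance.affineOpt_nonneg fun x i => ?_
  · simpa using hbound
  · simp only [Instance.OnGrid, Instance.ofPoints, Fin.forall_fin_add (m := n), Fin.append_left,
      Fin.append_right]
    exact ⟨fun j => hgrid (abscissa_le x j), fun _ => hgrid i.2.le⟩
  · rw [Instance.affineOpt_eq_zero_iff, ← forall_abscissa_ne_iff,
      ← exists_separating_parabola_iff (d := d)]
    simp [-neg_add_rev, Instance.ofPoints, Fin.forall_fin_add]

end Approximates

theorem div_log_le_self {x : ℝ} (hx : Real.exp 1 ≤ x) : x / Real.log x ≤ x :=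
  have hx₀ : 0 < x := (Real.exp_pos 1).trans_le hx
  div_le_self hx₀.le ((Real.le_log_iff_exp_le hx₀).2 hx)

end LogisticStreaming

theorem theorem2_general {δ : ℝ} (hδ : 0 ≤ δ) (hδ' : δ ≤ 1 / 2) {n : ℕ} (hn : 3 ≤ n) {α : ℝ}
    (hα : 0 < α) {Ω : Type*} [MeasurableSpace Ω] (μ : MeasureTheory.Measure Ω)
    [MeasureTheory.IsProbabilityMeasure μ] {d s : ℕ}
    (A : LogisticStreaming.StreamingAlgorithm Ω (d + 2) s) :
    (LogisticStreaming.Approximates μ A n (fun I => I.OnGrid (2 ^ n))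
        (fun I => I.opt) α δ →
      (1 - 2 * δ) ^ 2 / 4 * n ≤ s) ∧
    (LogisticStreaming.Approximates μ A n (fun I => I.OnGrid (n ^ 2))
        (fun I => I.affineOpt) α δ →
      (1 - 2 * δ) ^ 2 / 4 * n ≤ s) := by
  refine ⟨fun hA => ?_, fun hA => ?_⟩
  · have hbound := hA.sq_mul_le_space_of_opt hn hα hδ hδ'
    linarith [show 0 ≤ (1 - 2 * δ) ^ 2 * n by positivity]
  · obtain ⟨m, rfl⟩ : ∃ m, n = m + 1 := ⟨n - 1, by omega⟩
    have hbound := hA.sq_mul_le_space_of_affineOpt hα hδ hδ'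
    have hm : (1 : ℝ) ≤ m := by exact_mod_cast (by omega : 1 ≤ m)
    push_cast
    nlinarith [sq_nonneg (1 - 2 * δ)]

theorem theorem2 (δ : ℝ) (hδ : 0 ≤ δ) (hδ' : δ < 1 / 2) :
    ∃ c : ℝ, 0 < c ∧ ∃ n₀ : ℕ, ∀ n : ℕ, n₀ ≤ n → ∀ α : ℝ, 1 ≤ α →
      ∀ (Ω : Type*) [MeasurableSpace Ω] (μ : MeasureTheory.Measure Ω)
        [MeasureTheory.IsProbabilityMeasure μ]
        (s : ℕ) (A : LogisticStreaming.StreamingAlgorithm Ω 2 s),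
        (LogisticStreaming.Approximates μ A n (fun I => I.OnGrid (2 ^ n))
            (fun I => I.opt) α δ →
          c * (n / Real.log n) ≤ s) ∧
        (LogisticStreaming.Approximates μ A n (fun I => I.OnGrid (n ^ 2))
            (fun I => I.affineOpt) α δ →
          c * n ≤ s) := by
  have hc : 0 < (1 - 2 * δ) ^ 2 / 4 := by
    have hbias : 0 < 1 - 2 * δ := by linarith
    positivity
  refine ⟨_, hc, 3, fun n hn α hα Ω _ μ _ s A => ?_⟩
  have hexp : Real.exp 1 ≤ n := Real.exp_one_lt_three.le.trans (by exact_mod_cast hn)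
  exact (theorem2_general hδ hδ'.le hn (one_pos.trans_le hα) μ (d := 0) A).imp_left fun h hA =>
    (mul_le_mul_of_nonneg_left (LogisticStreaming.div_log_le_self hexp) hc.le).trans (h hA)
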